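/- Let $\mathrm{TL}$ be the Temperley–Lieb category over $\mathbb{C}(q)$: its objects are the integers $n\ge 0$, and $\mathrm{TL}(n,m)$ is the space of $\mathbb{C}(q)$-linear combinations of planar pictures of chords between $n$ bottom points and $m$ top points, up to isotopy relative to the boundary, where a disjoint circle may be removed at the cost of the factor $q+q^{-1}$. The product $ba$ is given by stacking $b$ on top of $a$, $1_n\in \mathrm{TL}_n=\mathrm{TL}(n,n)$ is the identity, $x\mapsto x\sqcup 1$ adjoins a vertical strand on the right, and $x\mapsto \bar x$ flips pictures upside down (both $\mathbb{C}(q)$-linearly). Let $e_i\in\mathrm{TL}_n$ be the elementary diagram with a cup and a cap at the positions $i,i+1$, let $[n]=\frac{q^n-q^{-n}}{q-q^{-1}}$, and let $p_n\in \mathrm{TL}_n$ be the Jones–Wenzl projectors: $p_0=1_0$, $p_1=1_1$ and $$p_n=(p_{n-1}\sqcup 1)-\frac{[n-1]}{[n]}\,(p_{n-1}\sqcup 1)\,e_{n-1}\,(p_{n-1}\sqcup 1)\qquad(n\ge 2).$$ Let $\mathcal{L}_n$ be the set of sequences $\epsilon=(i_1,\dots,i_n)\in\{1,-1\}^n$ with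 $i_1+\dots+i_k\ge 0$ for all $1\le k\le n$, put $|\epsilon|=i_1+\dots+i_n$, and let $\epsilon\cdot(\pm1)$ be the sequence $\epsilon$ with $\pm1$ appended. For $\epsilon\in\mathcal{L}_n$ with $|\epsilon|=k$ define $t_\epsilon\in \mathrm{TL}(k,n)$ inductively by $t_{()}=1_0$ (so that $t_{(1)}=1_1$) and $$t_{\epsilon\cdot(+1)}=(t_\epsilon\sqcup 1)\,p_{k+1},\qquad t_{\epsilon\cdot(-1)}=(t_\epsilon\sqcup 1)\,(p_k\sqcup 1)\,c_k\quad (k\ge 1),$$ where $c_k\in\mathrm{TL}(k-1,k+1)$ consists of $k-1$ vertical strands followed on the right by a cup. Put $q_\epsilon=t_\epsilon\bar t_\epsilon\in\mathrm{TL}_n$. Then: 1. for all $n\ge 0$ and all $\epsilon\ne\nu$ in $\mathcal{L}_n$, $q_\epsilon q_\nu=0$; 2. there are nonzero scalars $f_\epsilon\in\mathbb{C}(q)$, for all $n\ge0$ and $\epsilon\in\mathcal{L}_n$, such that the elements $p_\epsilon=f_\epsilon q_\epsilon\in \mathrm{TL}_n$ satisfy, for all $n\ge 0$ and all $\epsilon\in\mathcal{L}_n$,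 $$p_\epsilon p_\epsilon=p_\epsilon,\qquad 1_n=\sum_{\nu\in\mathcal{L}_n}p_\nu,\qquad p_\epsilon\sqcup 1=p_{\epsilon\cdot(+1)}+p_{\epsilon\cdot(-1)},$$ with the convention $p_\nu=0$ for a sequence $\nu$ that is not admissible. -/

import Mathlib

namespace TemperleyLieb

/-- The field `ℂ(q)`. -/
abbrev Cq : Type := RatFunc ℂ

/-- The variable `q`. -/
noncomputable def qv : Cq := RatFunc.X

/-- The value `q + q⁻¹` of a circle. -/
noncomputable def circleValue : Cq := qv + qv⁻¹

/-- The quantum integer `[n] = (q ^ n - q ^ (-n)) / (q - q⁻¹)`. -/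
noncomputable def qInt (n : ℕ) : Cq := (qv ^ n - qv⁻¹ ^ n) / (qv - qv⁻¹)

/-- Planar pictures from `n` bottom points to `m` top points, in generic position with respect to
the height function and read from bottom to top. `straight n` is `n` vertical strands;
`cup x i` puts a cup on top of `x`, with `i` strands to its left, so that its two ends are the top
points `i` and `i + 1` (points are counted from `0`, from left to right); `cap x i` puts a cap on
top of `x` that joins the top points `i` and `i + 1` of `x`. -/
inductive Picture : ℕ → ℕ → Type
  | straight (n : ℕ) : Picture n n
  | cup {n m : ℕ} (x : Picture n m) (i : ℕ) (hi : i ≤ m) : Picture n (m + 2)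
  | cap {n m : ℕ} (x : Picture n (m + 2)) (i : ℕ) (hi : i ≤ m) : Picture n m

namespace Picture

/-- `y.comp x`: the picture `y` stacked on top of `x`. -/
def comp {n m k : ℕ} : Picture m k → Picture n m → Picture n k
  | straight _, x => x
  | cup y i hi, x => cup (comp y x) i hi
  | cap y i hi, x => cap (comp y x) i hi

/-- `x ⊔ 1`: a vertical strand is added to the right of `x`. -/
def strand {n m : ℕ} : Picture n m → Picture (n + 1) (m + 1)
  | straight n => straight (n + 1)
  | cup x i hi => cup (strand x) i (Nat.le_succ_of_le hi)
  | cap x i hi => cap (strand x) i (Nat.le_succ_of_le hi)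

/-- `x` turned upside down (reflected in a horizontal line). -/
def flip {n m : ℕ} : Picture n m → Picture m n
  | straight n => straight n
  | cup (m := m) x i hi => (flip x).comp (cap (straight (m + 2)) i hi)
  | cap (m := m) x i hi => (flip x).comp (cup (straight m) i hi)

/-- Isotopy of pictures relative to the boundary. It is generated by the straightening of a
strand (`zigzag`) and by the exchange of the heights of two distant extrema (the other moves),
performed at any height in a picture. -/
inductive Isotopic : {n m : ℕ} → Picture n m → Picture n m → Prop
  | refl {n m : ℕ} (x : Picture n m) : Isotopic x x
  | symm {n m : ℕ} {x y : Picture n m} : Isotopic x y → Isotopic y x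
  | trans {n m : ℕ} {x y z : Picture n m} : Isotopic x y → Isotopic y z → Isotopic x z
  | cup_congr {n m : ℕ} {x y : Picture n m} (i : ℕ) (hi : i ≤ m) :
      Isotopic x y → Isotopic (cup x i hi) (cup y i hi)
  | cap_congr {n m : ℕ} {x y : Picture n (m + 2)} (i : ℕ) (hi : i ≤ m) :
      Isotopic x y → Isotopic (cap x i hi) (cap y i hi)
  | zigzag_right {n m : ℕ} (x : Picture n (m + 1)) (i : ℕ) (hi : i ≤ m) :
      Isotopic (cap (cup x (i + 1) (Nat.succ_le_succ hi)) i (Nat.le_succ_of_le hi)) x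
  | zigzag_left {n m : ℕ} (x : Picture n (m + 1)) (i : ℕ) (hi : i ≤ m) :
      Isotopic (cap (cup x i (Nat.le_succ_of_le hi)) (i + 1) (Nat.succ_le_succ hi)) x
  | cup_cup {n m : ℕ} (x : Picture n m) (i j : ℕ) (hij : i ≤ j) (hj : j ≤ m) :
      Isotopic
        (cup (cup x i (hij.trans hj)) (j + 2) (Nat.add_le_add_right hj 2))
        (cup (cup x j hj) i ((hij.trans hj).trans (Nat.le_add_right m 2)))
  | cap_cap {n m : ℕ} (x : Picture n (m + 2 + 2)) (i j : ℕ) (hij : i ≤ j) (hj : j ≤ m) :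
      Isotopic
        (cap (cap x (j + 2) (Nat.add_le_add_right hj 2)) i (hij.trans hj))
        (cap (cap x i ((hij.trans hj).trans (Nat.le_add_right m 2))) j hj)
  | cap_cup_right {n m : ℕ} (x : Picture n (m + 2)) (i j : ℕ) (hij : i ≤ j) (hj : j ≤ m) :
      Isotopic
        (cap (cup x i ((hij.trans hj).trans (Nat.le_add_right m 2))) (j + 2)
          (Nat.add_le_add_right hj 2))
        (cup (cap x j hj) i (hij.trans hj))
  | cap_cup_left {n m : ℕ} (x : Picture n (m + 2)) (i j : ℕ) (hij : i ≤ j) (hj : j ≤ m) :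
      Isotopic
        (cap (cup x (j + 2) (Nat.add_le_add_right hj 2)) i
          ((hij.trans hj).trans (Nat.le_add_right m 2)))
        (cup (cap x i (hij.trans hj)) j hj)

theorem comp_assoc {n m k l : ℕ} (z : Picture k l) (y : Picture m k) (x : Picture n m) :
    (z.comp y).comp x = z.comp (y.comp x) := by
  induction z with
  | straight => rfl
  | cup z i hi ih => simp only [comp, ih]
  | cap z i hi ih => simp only [comp, ih]

theorem strand_comp {n m k : ℕ} (y : Picture m k) (x : Picture n m) :
    (y.comp x).strand = y.strand.comp x.strand := by
  induction y with
  | straight => rfl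
  | cup y i hi ih => simp only [comp, strand, ih]
  | cap y i hi ih => simp only [comp, strand, ih]

theorem comp_straight {n m : ℕ} (y : Picture n m) : y.comp (straight n) = y := by
  induction y with
  | straight => rfl
  | cup y i hi ih => simp only [comp, ih]
  | cap y i hi ih => simp only [comp, ih]

theorem flip_comp {n m k : ℕ} (y : Picture m k) (x : Picture n m) :
    (y.comp x).flip = x.flip.comp y.flip := by
  induction y with
  | straight => simp only [comp, flip, comp_straight]
  | cup y i hi ih => simp only [comp, flip, ih, comp_assoc]
  | cap y i hi ih => simp only [comp, flip, ih, comp_assoc]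

theorem Isotopic.comp_left {n m k : ℕ} (y : Picture m k) {x x' : Picture n m}
    (h : Isotopic x x') : Isotopic (y.comp x) (y.comp x') := by
  induction y with
  | straight => exact h
  | cup y i hi ih => exact ih.cup_congr i hi
  | cap y i hi ih => exact ih.cap_congr i hi

theorem Isotopic.comp_right {n m k : ℕ} {y y' : Picture m k} (h : Isotopic y y')
    (x : Picture n m) : Isotopic (y.comp x) (y'.comp x) := by
  induction h with
  | refl y => exact .refl _
  | symm _ ih => exact ih.symm
  | trans _ _ ih ih' => exact ih.trans ih'
  | cup_congr i hi _ ih => exact ih.cup_congr i hi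
  | cap_congr i hi _ ih => exact ih.cap_congr i hi
  | zigzag_right y i hi => exact .zigzag_right _ i hi
  | zigzag_left y i hi => exact .zigzag_left _ i hi
  | cup_cup y i j hij hj => exact .cup_cup _ i j hij hj
  | cap_cap y i j hij hj => exact .cap_cap _ i j hij hj
  | cap_cup_right y i j hij hj => exact .cap_cup_right _ i j hij hj
  | cap_cup_left y i j hij hj => exact .cap_cup_left _ i j hij hj

theorem Isotopic.strand {n m : ℕ} {x y : Picture n m} (h : Isotopic x y) :
    Isotopic x.strand y.strand := by
  induction h with
  | refl x => exact .refl _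
  | symm _ ih => exact ih.symm
  | trans _ _ ih ih' => exact ih.trans ih'
  | cup_congr i hi _ ih => exact ih.cup_congr i _
  | cap_congr i hi _ ih => exact ih.cap_congr i _
  | zigzag_right x i hi => exact .zigzag_right _ i (Nat.le_succ_of_le hi)
  | zigzag_left x i hi => exact .zigzag_left _ i (Nat.le_succ_of_le hi)
  | cup_cup x i j hij hj => exact .cup_cup _ i j hij (Nat.le_succ_of_le hj)
  | cap_cap x i j hij hj => exact .cap_cap _ i j hij (Nat.le_succ_of_le hj)
  | cap_cup_right x i j hij hj => exact .cap_cup_right _ i j hij (Nat.le_succ_of_le hj)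
  | cap_cup_left x i j hij hj => exact .cap_cup_left _ i j hij (Nat.le_succ_of_le hj)

theorem Isotopic.flip {n m : ℕ} {x y : Picture n m} (h : Isotopic x y) :
    Isotopic x.flip y.flip := by
  induction h with
  | refl x => exact .refl _
  | symm _ ih => exact ih.symm
  | trans _ _ ih ih' => exact ih.trans ih'
  | cup_congr i hi _ ih => exact ih.comp_right _
  | cap_congr i hi _ ih => exact ih.comp_right _
  | zigzag_right x i hi =>
      have := (Isotopic.zigzag_left (straight _) i hi).comp_left x.flip
      simpa only [Picture.flip, comp_assoc, comp, comp_straight] using this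
  | zigzag_left x i hi =>
      have := (Isotopic.zigzag_right (straight _) i hi).comp_left x.flip
      simpa only [Picture.flip, comp_assoc, comp, comp_straight] using this
  | cup_cup x i j hij hj =>
      have := (Isotopic.cap_cap (straight _) i j hij hj).comp_left x.flip
      simpa only [Picture.flip, comp_assoc, comp, comp_straight] using this
  | cap_cap x i j hij hj =>
      have := (Isotopic.cup_cup (straight _) i j hij hj).comp_left x.flip
      simpa only [Picture.flip, comp_assoc, comp, comp_straight] using this
  | cap_cup_right x i j hij hj =>
      have := (Isotopic.cap_cup_left (straight _) i j hij hj).comp_left x.flip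
      simpa only [Picture.flip, comp_assoc, comp, comp_straight] using this
  | cap_cup_left x i j hij hj =>
      have := (Isotopic.cap_cup_right (straight _) i j hij hj).comp_left x.flip
      simpa only [Picture.flip, comp_assoc, comp, comp_straight] using this

end Picture

/-- The relations imposed on `ℂ(q)`-linear combinations of pictures: isotopic pictures are equal,
and a disjoint circle, anywhere in a picture, is removed at the cost of the factor `q + q⁻¹`. -/
inductive Relation (n m : ℕ) : (Picture n m →₀ Cq) → Prop
  | isotopy (x y : Picture n m) (h : x.Isotopic y) :
      Relation n m (Finsupp.single x 1 - Finsupp.single y 1)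
  | circle {k : ℕ} (y : Picture k m) (x : Picture n k) (i : ℕ) (hi : i ≤ k) :
      Relation n m (Finsupp.single (y.comp (.cap (.cup x i hi) i hi)) 1 -
        circleValue • Finsupp.single (y.comp x) 1)

/-- The span of the relations. -/
noncomputable def relations (n m : ℕ) : Submodule Cq (Picture n m →₀ Cq) :=
  Submodule.span Cq {r | Relation n m r}

/-- The space `TL(n, m)` of morphisms from `n` to `m` in the Temperley-Lieb category. -/
abbrev TL (n m : ℕ) : Type := (Picture n m →₀ Cq) ⧸ relations n m

/-- The element of `TL(n, m)` represented by a picture. -/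
noncomputable def ofPicture {n m : ℕ} (x : Picture n m) : TL n m :=
  (relations n m).mkQ (Finsupp.single x 1)

/-- An operation on pictures that respects the relations respects their span. -/
theorem relations_le_comap {n m n' m' : ℕ} (f : Picture n m → Picture n' m')
    (hf : ∀ r, Relation n m r → Relation n' m' (Finsupp.lmapDomain Cq Cq f r)) :
    relations n m ≤ (relations n' m').comap (Finsupp.lmapDomain Cq Cq f) :=
  Submodule.span_le.2 fun r hr => Submodule.subset_span (hf r hr)

theorem relation_strand {n m : ℕ} (r : Picture n m →₀ Cq) (hr : Relation n m r) :
    Relation (n + 1) (m + 1) (Finsupp.lmapDomain Cq Cq Picture.strand r) := by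
  cases hr with
  | isotopy x y h =>
      simpa only [map_sub, Finsupp.lmapDomain_apply, Finsupp.mapDomain_single] using
        Relation.isotopy _ _ h.strand
  | circle y x i hi =>
      simpa only [map_sub, map_smul, Finsupp.lmapDomain_apply, Finsupp.mapDomain_single, Picture.strand_comp, Picture.strand] using
        Relation.circle y.strand x.strand i (Nat.le_succ_of_le hi)

theorem relation_flip {n m : ℕ} (r : Picture n m →₀ Cq) (hr : Relation n m r) :
    Relation m n (Finsupp.lmapDomain Cq Cq Picture.flip r) := by
  cases hr with
  | isotopy x y h =>
      simpa only [map_sub, Finsupp.lmapDomain_apply, Finsupp.mapDomain_single] using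
        Relation.isotopy _ _ h.flip
  | circle y x i hi =>
      simpa only [map_sub, map_smul, Finsupp.lmapDomain_apply, Finsupp.mapDomain_single, Picture.flip_comp, Picture.flip, Picture.comp_assoc, Picture.comp] using
        Relation.circle x.flip y.flip i hi

theorem relation_comp_left {n m k : ℕ} (z : Picture m k) (r : Picture n m →₀ Cq)
    (hr : Relation n m r) : Relation n k (Finsupp.lmapDomain Cq Cq z.comp r) := by
  cases hr with
  | isotopy x y h =>
      simpa only [map_sub, Finsupp.lmapDomain_apply, Finsupp.mapDomain_single] using
        Relation.isotopy _ _ (h.comp_left z)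
  | circle y x i hi =>
      simpa only [map_sub, map_smul, Finsupp.lmapDomain_apply, Finsupp.mapDomain_single, Picture.comp_assoc] using Relation.circle (z.comp y) x i hi

theorem relation_comp_right {n m k : ℕ} (z : Picture n m) (r : Picture m k →₀ Cq)
    (hr : Relation m k r) : Relation n k (Finsupp.lmapDomain Cq Cq (fun y => y.comp z) r) := by
  cases hr with
  | isotopy x y h =>
      simpa only [map_sub, Finsupp.lmapDomain_apply, Finsupp.mapDomain_single] using
        Relation.isotopy _ _ (h.comp_right z)
  | circle y x i hi =>
      simpa only [map_sub, map_smul, Finsupp.lmapDomain_apply, Finsupp.mapDomain_single, Picture.comp_assoc, Picture.comp] using Relation.circle y (x.comp z) i hi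

/-- `x ↦ x ⊔ 1`, extended linearly from pictures. -/
noncomputable def strand {n m : ℕ} : TL n m →ₗ[Cq] TL (n + 1) (m + 1) :=
  (relations n m).mapQ (relations (n + 1) (m + 1)) (Finsupp.lmapDomain Cq Cq Picture.strand)
    (relations_le_comap _ relation_strand)

/-- `x ↦ x̄`, extended linearly from pictures. -/
noncomputable def bar {n m : ℕ} : TL n m →ₗ[Cq] TL m n :=
  (relations n m).mapQ (relations m n) (Finsupp.lmapDomain Cq Cq Picture.flip)
    (relations_le_comap _ relation_flip)

/-- `x ↦ z x` for a picture `z`. -/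
noncomputable def pictureComp {n m k : ℕ} (z : Picture m k) : TL n m →ₗ[Cq] TL n k :=
  (relations n m).mapQ (relations n k) (Finsupp.lmapDomain Cq Cq z.comp)
    (relations_le_comap _ (relation_comp_left z))

theorem pictureComp_ofPicture {n m k : ℕ} (z : Picture m k) (x : Picture n m) :
    pictureComp z (ofPicture x) = ofPicture (z.comp x) := by
  simp [pictureComp, ofPicture]

theorem linearCombination_pictureComp {n m k : ℕ} (r : Picture m k →₀ Cq) (x : Picture n m) :
    Finsupp.linearCombination Cq (fun z : Picture m k => pictureComp (n := n) z) r (ofPicture x) =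
      (relations n k).mkQ (Finsupp.lmapDomain Cq Cq (fun y => y.comp x) r) := by
  induction r using Finsupp.induction_linear with
  | zero => simp
  | add f g hf hg => rw [map_add, LinearMap.add_apply, hf, hg, map_add, map_add]
  | single z c =>
      rw [Finsupp.linearCombination_single, LinearMap.smul_apply, pictureComp_ofPicture, ofPicture,
        ← map_smul, Finsupp.smul_single, smul_eq_mul, mul_one, Finsupp.lmapDomain_apply,
        Finsupp.mapDomain_single]

theorem relations_le_ker {n m k : ℕ} :
    relations m k ≤ LinearMap.ker
      (Finsupp.linearCombination Cq fun z : Picture m k => pictureComp (n := n) z) := by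
  refine Submodule.span_le.2 fun r hr => ?_
  rw [SetLike.mem_coe, LinearMap.mem_ker]
  refine Submodule.linearMap_qext _ (Finsupp.lhom_ext' fun x => LinearMap.ext_ring ?_)
  refine (linearCombination_pictureComp r x).trans ?_
  exact (Submodule.Quotient.mk_eq_zero _).2
    (Submodule.subset_span (relation_comp_right x r hr))

/-- The composition `y x` of `x ∈ TL(n, m)` and `y ∈ TL(m, k)`: the bilinear extension of stacking
`y` on top of `x`. -/
noncomputable def comp {n m k : ℕ} : TL m k →ₗ[Cq] TL n m →ₗ[Cq] TL n k :=
  (relations m k).liftQ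
    (Finsupp.linearCombination Cq fun z : Picture m k => pictureComp (n := n) z) relations_le_ker

/-- The identity `1_n` of `TL_n = TL(n, n)`. -/
noncomputable def one (n : ℕ) : TL n n := ofPicture (.straight n)

/-- The diagram in `TL(n, n + 2)` with `i` vertical strands, a cup, and `n - i` more strands. -/
noncomputable def cupAt (n i : ℕ) (hi : i ≤ n) : TL n (n + 2) :=
  ofPicture (.cup (.straight n) i hi)

/-- The elementary diagram in `TL_(n + 2)` whose two horizontal chords connect the positions
`i` and `i + 1`, counted from `0`; so this is `e_(i + 1)` if positions are counted from `1`. -/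
noncomputable def elementary (n i : ℕ) (hi : i ≤ n) : TL (n + 2) (n + 2) :=
  ofPicture (.cup (.cap (.straight (n + 2)) i hi) i hi)

/-- The Jones-Wenzl projectors by Wenzl's recurrence
`p_n = p_(n-1) ⊔ 1 - [n-1]/[n] (p_(n-1) ⊔ 1) e_(n-1) (p_(n-1) ⊔ 1)`; `p_0` and `p_1` are the
identities. -/
noncomputable def jonesWenzl : (n : ℕ) → TL n n
  | 0 => one 0
  | 1 => one 1
  | n + 2 => strand (jonesWenzl (n + 1)) - (qInt (n + 1) / qInt (n + 2)) •
      comp (strand (jonesWenzl (n + 1)))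
        (comp (elementary n n le_rfl) (strand (jonesWenzl (n + 1))))

/-- The size `|ε| = ε_1 + ⋯ + ε_n` of a sequence of signs. -/
def size {n : ℕ} (ε : Fin n → ℤˣ) : ℤ := ∑ i, (ε i : ℤ)

/-- A sequence of signs is admissible if its partial sums are nonnegative. -/
def Admissible {n : ℕ} (ε : Fin n → ℤˣ) : Prop :=
  ∀ k ∈ Finset.Icc 1 n, 0 ≤ ∑ i ∈ Finset.univ.filter fun i : Fin n => (i : ℕ) < k, (ε i : ℤ)

instance {n : ℕ} : DecidablePred (Admissible (n := n)) := fun ε => by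
  unfold Admissible; infer_instance

/-- The set `L_n` of the admissible sequences of length `n`. -/
def L (n : ℕ) : Finset (Fin n → ℤˣ) := Finset.univ.filter Admissible

/-- For an admissible sequence `ε` of length `n` and size `k`, this is `t_ε ∈ TL(k, n)`, given by
`t_() = 1_0`, `t_(ε·(+1)) = (t_ε ⊔ 1) p_(k+1)` and
`t_(ε·(-1)) = (t_ε ⊔ 1) (p_k ⊔ 1) (1_(k-1) ⊔ cup)`, where `k = |ε|`; in particular `t_((1)) = 1_1`.
It is `0` if `k` is not the size of `ε` or `ε` is not admissible. -/
noncomputable def top : (n k : ℕ) → (Fin n → ℤˣ) → TL k n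
  | 0, 0, _ => one 0
  | 0, _ + 1, _ => 0
  | n + 1, 0, ε =>
      if ε (Fin.last n) = 1 then 0
      else comp (strand (top n 1 (Fin.init ε)))
        (comp (strand (jonesWenzl 1)) (cupAt 0 0 le_rfl))
  | n + 1, k + 1, ε =>
      if ε (Fin.last n) = 1 then
        comp (strand (top n k (Fin.init ε))) (jonesWenzl (k + 1))
      else comp (strand (top n (k + 2) (Fin.init ε)))
        (comp (strand (jonesWenzl (k + 2))) (cupAt (k + 1) (k + 1) le_rfl))

/-- The element `q_ε = t_ε t̄_ε` of `TL_n`, for `ε ∈ L_n`. -/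
noncomputable def qElt {n : ℕ} (ε : Fin n → ℤˣ) : TL n n :=
  comp (top n (size ε).toNat ε) (bar (top n (size ε).toNat ε))

end TemperleyLieb

/-! Up to scalars, the elements `t_ε` with their flips behave like matrix units: for admissible `ε`,
`ν`, the product `t̄_ε t_ν` vanishes if `ε ≠ ν` and equals `f_ε⁻¹ p_k` with `k = |ε|` if `ε = ν`
(`bar_top_comp_top_of_ne`, `bar_top_comp_top_self`). Both follow by induction on the length.
Stripping the last signs leaves `t̄_μ t_ρ ⊔ 1` in the middle, for the prefixes `μ`, `ρ`. It is zero
if these differ, and a multiple of a Jones-Wenzl projector with a strand otherwise. Then only the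
last signs matter: two signs `+1` give a projector, two signs `-1` a partial trace with factor
`[k+1]/[k]`, where `k = |μ|`, and mixed signs a projector composed with a cup, which is zero. These
facts about projectors are `jonesWenzl_properties`.

Orthogonality is then immediate, and `f_ε q_ε` is idempotent because `t_ε p_k = t_ε`. The branching
rule is Wenzl's recurrence placed between `t_ε ⊔ 1` and its flip: the factor `[k]/[k+1]` that `f`
gains at a sign `-1` is the coefficient of the recurrence. Iterating the branching rule from `1_0`
decomposes the identity. -/

namespace TemperleyLieb

/-! ### Isotopies of pictures -/

namespace Picture

theorem flip_strand {n m : ℕ} (x : Picture n m) : x.strand.flip = x.flip.strand := by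
  induction x with
  | straight => rfl
  | cup x i hi ih => simp only [strand, flip, ih, strand_comp]
  | cap x i hi ih => simp only [strand, flip, ih, strand_comp]

theorem flip_flip {n m : ℕ} (x : Picture n m) : x.flip.flip = x := by
  induction x with
  | straight => rfl
  | cup x i hi ih => simp only [flip, flip_comp, ih, comp]
  | cap x i hi ih => simp only [flip, flip_comp, ih, comp]

/-- A cup on the far right can be slid through a picture. -/
theorem Isotopic.strand_strand_comp_cup {n m : ℕ} (x : Picture n m) :
    Isotopic (x.strand.strand.comp (cup (straight n) n le_rfl)) (cup x m le_rfl) := by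
  induction x with
  | straight => exact .refl _
  -- Each extremum of `x` lies to the left of the sliding cup, so a single exchange of heights
  -- suffices.
  | cup x i hi ih => exact (ih.cup_congr i _).trans (Isotopic.cup_cup x i _ hi le_rfl).symm
  | cap x i hi ih => exact (ih.cap_congr i _).trans (Isotopic.cap_cup_left x i _ hi le_rfl)

end Picture

/-! ### Categorical structure of TL, flips, cups and caps -/

section Category

variable {n m k l : ℕ}

@[elab_as_elim]
-- Reduces the multilinear identities below to the same identities between pictures.
theorem TL.induction {P : TL n m → Prop} (x : TL n m) (zero : P 0)
    (pic : ∀ x, P (ofPicture x)) (add : ∀ x y, P x → P y → P (x + y))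
    (smul : ∀ (c : Cq) x, P x → P (c • x)) : P x := by
  obtain ⟨r, rfl⟩ := Submodule.mkQ_surjective _ x
  induction r using Finsupp.induction_linear with
  | zero => rwa [map_zero]
  | add f g hf hg => rw [map_add]; exact add _ _ hf hg
  | single x c =>
      have := smul c _ (pic x)
      rwa [ofPicture, ← map_smul, Finsupp.smul_single, smul_eq_mul, mul_one] at this

theorem ofPicture_eq_of_isotopic {x y : Picture n m} (h : x.Isotopic y) :
    ofPicture x = ofPicture y := by
  rw [ofPicture, ofPicture, ← sub_eq_zero, ← map_sub]
  exact (Submodule.Quotient.mk_eq_zero _).2 (Submodule.subset_span (.isotopy x y h))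

theorem ofPicture_circle (x : Picture n m) (i : ℕ) (hi : i ≤ m) :
    ofPicture (.cap (.cup x i hi) i hi) = circleValue • ofPicture x := by
  rw [ofPicture, ofPicture, ← sub_eq_zero, ← map_smul, ← map_sub]
  exact (Submodule.Quotient.mk_eq_zero _).2
    (Submodule.subset_span (.circle (.straight m) x i hi))

theorem comp_ofPicture (y : Picture m k) (x : Picture n m) :
    comp (ofPicture y) (ofPicture x) = ofPicture (y.comp x) := by
  rw [← pictureComp_ofPicture]
  simp [comp, ofPicture]

theorem strand_ofPicture (x : Picture n m) : strand (ofPicture x) = ofPicture x.strand := by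
  simp [strand, ofPicture]

theorem bar_ofPicture (x : Picture n m) : bar (ofPicture x) = ofPicture x.flip := by
  simp [bar, ofPicture]

theorem comp_assoc (z : TL k l) (y : TL m k) (x : TL n m) :
    comp (comp z y) x = comp z (comp y x) := by
  induction z using TL.induction with
  | zero => simp
  | add a b ha hb => simp only [map_add, LinearMap.add_apply, ha, hb]
  | smul c a ha => simp only [map_smul, LinearMap.smul_apply, ha]
  | pic z =>
    induction y using TL.induction with
    | zero => simp
    | add a b ha hb => simp only [map_add, LinearMap.add_apply, ha, hb]
    | smul c a ha => simp only [map_smul, LinearMap.smul_apply, ha]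
    | pic y =>
      induction x using TL.induction with
      | zero => simp
      | add a b ha hb => simp only [map_add, ha, hb]
      | smul c a ha => simp only [map_smul, ha]
      | pic x => simp only [comp_ofPicture, Picture.comp_assoc]

theorem one_comp (x : TL n m) : comp (one m) x = x := by
  induction x using TL.induction with
  | zero => simp
  | add a b ha hb => simp only [map_add, ha, hb]
  | smul c a ha => simp only [map_smul, ha]
  | pic x => simp only [one, comp_ofPicture, Picture.comp]

theorem comp_one (x : TL n m) : comp x (one n) = x := by
  induction x using TL.induction with
  | zero => simp
  | add a b ha hb => simp only [map_add, LinearMap.add_apply, ha, hb]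
  | smul c a ha => simp only [map_smul, LinearMap.smul_apply, ha]
  | pic x => simp only [one, comp_ofPicture, Picture.comp_straight]

theorem strand_one (n : ℕ) : strand (one n) = one (n + 1) :=
  strand_ofPicture _

theorem bar_one (n : ℕ) : bar (one n) = one n :=
  bar_ofPicture _

theorem strand_comp (y : TL m k) (x : TL n m) :
    strand (comp y x) = comp (strand y) (strand x) := by
  induction y using TL.induction with
  | zero => simp
  | add a b ha hb => simp only [map_add, LinearMap.add_apply, ha, hb]
  | smul c a ha => simp only [map_smul, LinearMap.smul_apply, ha]
  | pic y =>
    induction x using TL.induction with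
    | zero => simp
    | add a b ha hb => simp only [map_add, ha, hb]
    | smul c a ha => simp only [map_smul, ha]
    | pic x => simp only [comp_ofPicture, strand_ofPicture, Picture.strand_comp]

theorem bar_comp (y : TL m k) (x : TL n m) : bar (comp y x) = comp (bar x) (bar y) := by
  induction y using TL.induction with
  | zero => simp
  | add a b ha hb => simp only [map_add, LinearMap.add_apply, ha, hb]
  | smul c a ha => simp only [map_smul, LinearMap.smul_apply, ha]
  | pic y =>
    induction x using TL.induction with
    | zero => simp
    | add a b ha hb => simp only [map_add, LinearMap.add_apply, ha, hb]
    | smul c a ha => simp only [map_smul, LinearMap.smul_apply, ha]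
    | pic x => simp only [comp_ofPicture, bar_ofPicture, Picture.flip_comp]

theorem bar_strand (x : TL n m) : bar (strand x) = strand (bar x) := by
  induction x using TL.induction with
  | zero => simp
  | add a b ha hb => simp only [map_add, ha, hb]
  | smul c a ha => simp only [map_smul, ha]
  | pic x => simp only [strand_ofPicture, bar_ofPicture, Picture.flip_strand]

theorem bar_bar (x : TL n m) : bar (bar x) = x := by
  induction x using TL.induction with
  | zero => simp
  | add a b ha hb => simp only [map_add, ha, hb]
  | smul c a ha => simp only [map_smul, ha]
  | pic x => simp only [bar_ofPicture, Picture.flip_flip]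

/-- The diagram in `TL(n + 2, n)` with `n` vertical strands followed by a cap. -/
noncomputable def capLast (n : ℕ) : TL (n + 2) n :=
  ofPicture (.cap (.straight (n + 2)) n le_rfl)

/-- The diagram in `TL(n, n + 2)` with `n` vertical strands followed by a cup. -/
noncomputable def cupLast (n : ℕ) : TL n (n + 2) :=
  cupAt n n le_rfl

theorem bar_cupLast (n : ℕ) : bar (cupLast n) = capLast n :=
  bar_ofPicture _

theorem bar_capLast (n : ℕ) : bar (capLast n) = cupLast n :=
  bar_ofPicture _

theorem elementary_last (n : ℕ) :
    elementary n n le_rfl = comp (cupLast n) (capLast n) := by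
  rw [cupLast, cupAt, capLast, comp_ofPicture]; rfl

/-- Naturality of the rightmost cup; it moves projectors across cups in all later computations. -/
theorem strand_strand_comp_cupLast (x : TL n m) :
    comp (strand (strand x)) (cupLast n) = comp (cupLast m) x := by
  induction x using TL.induction with
  | zero => simp
  | add a b ha hb => simp only [map_add, LinearMap.add_apply, ha, hb]
  | smul c a ha => simp only [map_smul, LinearMap.smul_apply, ha]
  | pic x =>
    simp only [strand_ofPicture, cupLast, cupAt, comp_ofPicture]
    exact ofPicture_eq_of_isotopic (.strand_strand_comp_cup x)

theorem capLast_comp_strand_strand (x : TL n m) :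
    comp (capLast m) (strand (strand x)) = comp x (capLast n) := by
  have := congrArg bar (strand_strand_comp_cupLast (bar x))
  simpa only [bar_comp, bar_strand, bar_bar, bar_cupLast] using this

theorem capLast_comp_cupLast (n : ℕ) :
    comp (capLast n) (cupLast n) = circleValue • one n := by
  rw [capLast, cupLast, cupAt, comp_ofPicture]
  exact ofPicture_circle _ _ _

theorem capLast_comp_strand_cupLast (n : ℕ) :
    comp (capLast (n + 1)) (strand (cupLast n)) = one (n + 1) := by
  rw [capLast, cupLast, cupAt, strand_ofPicture, comp_ofPicture]
  exact ofPicture_eq_of_isotopic (.zigzag_left _ n le_rfl)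

theorem strand_capLast_comp_cupLast (n : ℕ) :
    comp (strand (capLast n)) (cupLast (n + 1)) = one (n + 1) := by
  rw [capLast, cupLast, cupAt, strand_ofPicture, comp_ofPicture]
  exact ofPicture_eq_of_isotopic (.zigzag_right _ n le_rfl)

end Category

/-! ### Quantum integers -/

section QuantumIntegers

theorem qv_ne_zero : qv ≠ 0 := RatFunc.X_ne_zero

theorem qv_pow_ne_one {n : ℕ} (hn : n ≠ 0) : qv ^ n ≠ 1 := by
  intro h
  have h' : algebraMap (Polynomial ℂ) Cq (Polynomial.X ^ n) = algebraMap _ _ 1 := by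
    rw [map_pow, RatFunc.algebraMap_X, map_one]; exact h
  -- In `ℂ[X]` the two sides have degrees `n` and `0`.
  have := congrArg Polynomial.natDegree (RatFunc.algebraMap_injective ℂ h')
  simp [hn] at this

theorem qv_pow_sub_ne_zero {n : ℕ} (hn : n ≠ 0) : qv ^ n - qv⁻¹ ^ n ≠ 0 := by
  intro h
  apply qv_pow_ne_one (n := n + n) (by omega)
  rw [sub_eq_zero, inv_pow] at h
  rw [pow_add]
  nth_rewrite 2 [h]
  exact mul_inv_cancel₀ (pow_ne_zero _ qv_ne_zero)

theorem qv_sub_ne_zero : qv - qv⁻¹ ≠ 0 := by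
  simpa using qv_pow_sub_ne_zero one_ne_zero

theorem qInt_ne_zero {n : ℕ} (hn : n ≠ 0) : qInt n ≠ 0 :=
  div_ne_zero (qv_pow_sub_ne_zero hn) qv_sub_ne_zero

theorem qInt_one : qInt 1 = 1 := by
  simpa [qInt] using div_self qv_sub_ne_zero

theorem circleValue_mul_qInt (n : ℕ) :
    circleValue * qInt (n + 1) = qInt (n + 2) + qInt n := by
  rw [circleValue, qInt, qInt, qInt, ← add_div, ← mul_div_assoc]
  congr 1
  have h : qv * qv⁻¹ = 1 := mul_inv_cancel₀ qv_ne_zero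
  linear_combination (qv ^ n - qv⁻¹ ^ n) * h

theorem qInt_two : qInt 2 = circleValue := by
  simpa [qInt_one, show qInt 0 = 0 by simp [qInt]] using (circleValue_mul_qInt 0).symm

/-- The scalar of the partial trace: a circle from the leading term of Wenzl's recurrence, minus the
coefficient of its correction term. -/
theorem circleValue_sub (n : ℕ) :
    circleValue - qInt n / qInt (n + 1) = qInt (n + 2) / qInt (n + 1) := by
  rw [sub_eq_iff_eq_add, ← add_div, ← circleValue_mul_qInt,
    mul_div_cancel_right₀ _ (qInt_ne_zero n.succ_ne_zero)]

end QuantumIntegers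

/-! ### Jones-Wenzl projectors -/

section JonesWenzl

/-- Wenzl's recurrence with the elementary diagram cut into a cup and a cap. -/
theorem jonesWenzl_add_two (n : ℕ) :
    jonesWenzl (n + 2) = strand (jonesWenzl (n + 1)) - (qInt (n + 1) / qInt (n + 2)) •
      comp (comp (strand (jonesWenzl (n + 1))) (cupLast n))
        (comp (capLast n) (strand (jonesWenzl (n + 1)))) := by
  rw [jonesWenzl, elementary_last]
  simp only [comp_assoc]

theorem bar_jonesWenzl (n : ℕ) : bar (jonesWenzl n) = jonesWenzl n := by
  match n with
  | 0 => exact bar_one 0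
  | 1 => exact bar_one 1
  | n + 2 =>
    rw [jonesWenzl_add_two]
    simp only [map_sub, map_smul, bar_comp, bar_strand, bar_jonesWenzl (n + 1), bar_cupLast,
      bar_capLast]

/-- The four properties are proved together because they feed each other: idempotence gives
absorption for the next projector, absorption and annihilation of the cup give its idempotence, and
absorption and the partial trace give the next annihilation. -/
theorem jonesWenzl_properties (n : ℕ) :
    comp (jonesWenzl (n + 1)) (jonesWenzl (n + 1)) = jonesWenzl (n + 1) ∧
    comp (jonesWenzl (n + 1)) (strand (jonesWenzl n)) = jonesWenzl (n + 1) ∧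
    comp (capLast n) (comp (strand (jonesWenzl (n + 1))) (cupLast n)) =
      (qInt (n + 2) / qInt (n + 1)) • jonesWenzl n ∧
    comp (jonesWenzl (n + 2)) (cupLast n) = 0 := by
  have annihilate (n : ℕ)
      (h₁ : comp (jonesWenzl (n + 1)) (strand (jonesWenzl n)) = jonesWenzl (n + 1))
      (h₂ : comp (capLast n) (comp (strand (jonesWenzl (n + 1))) (cupLast n)) =
        (qInt (n + 2) / qInt (n + 1)) • jonesWenzl n) :
      comp (jonesWenzl (n + 2)) (cupLast n) = 0 := by
    rw [jonesWenzl_add_two]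
    simp only [map_sub, map_smul, LinearMap.sub_apply, LinearMap.smul_apply, comp_assoc, h₂]
    -- The coefficient cancels the partial trace scalar. The remaining `p_n` slides through the cup
    -- and is absorbed, so both terms of the recurrence agree.
    rw [← strand_strand_comp_cupLast, ← comp_assoc, ← strand_comp, h₁, smul_smul,
      div_mul_div_cancel₀ (qInt_ne_zero (by omega)), div_self (qInt_ne_zero (by omega)),
      one_smul, sub_self]
  induction n with
  | zero =>
    have h₁ : comp (jonesWenzl 1) (strand (jonesWenzl 0)) = jonesWenzl 1 := by
      simp only [jonesWenzl, strand_one, one_comp]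
    have h₂ : comp (capLast 0) (comp (strand (jonesWenzl 1)) (cupLast 0)) =
        (qInt 2 / qInt 1) • jonesWenzl 0 := by
      simp only [jonesWenzl, strand_one, one_comp, capLast_comp_cupLast, qInt_one, qInt_two,
        div_one]
    exact ⟨one_comp _, h₁, h₂, annihilate 0 h₁ h₂⟩
  | succ n ih =>
    obtain ⟨idem, absorb, trace, kill⟩ := ih
    have h₁ : comp (jonesWenzl (n + 2)) (strand (jonesWenzl (n + 1))) = jonesWenzl (n + 2) := by
      rw [jonesWenzl_add_two]
      simp only [map_sub, map_smul, LinearMap.sub_apply, LinearMap.smul_apply, comp_assoc,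
        ← strand_comp, idem]
    have h₀ : comp (jonesWenzl (n + 2)) (jonesWenzl (n + 2)) = jonesWenzl (n + 2) := by
      -- Only the right factor is expanded; its correction term contains a cup that the left factor
      -- annihilates after absorption.
      refine (congrArg (comp (jonesWenzl (n + 2))) (jonesWenzl_add_two n)).trans ?_
      simp only [map_sub, map_smul, ← comp_assoc, h₁, kill, map_zero, LinearMap.zero_apply,
        smul_zero, sub_zero]
    have h₂ : comp (capLast (n + 1)) (comp (strand (jonesWenzl (n + 2))) (cupLast (n + 1))) =
        (qInt (n + 3) / qInt (n + 2)) • jonesWenzl (n + 1) := by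
      rw [← circleValue_sub, sub_smul, jonesWenzl_add_two]
      simp only [map_sub, map_smul, LinearMap.sub_apply, LinearMap.smul_apply, strand_comp,
        comp_assoc, strand_strand_comp_cupLast]
      congr 1
      · rw [← comp_assoc, capLast_comp_cupLast, map_smul, LinearMap.smul_apply, one_comp]
      -- In the correction term both zigzags straighten, leaving `p_(n+1) p_(n+1)`.
      · rw [← comp_assoc (capLast (n + 1)), capLast_comp_strand_strand, comp_assoc,
          ← comp_assoc (capLast (n + 1)), capLast_comp_strand_cupLast, one_comp,
          ← comp_assoc (strand (capLast n)), strand_capLast_comp_cupLast, one_comp, idem]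
    exact ⟨h₀, h₁, h₂, annihilate _ h₁ h₂⟩

theorem jonesWenzl_comp_self (n : ℕ) : comp (jonesWenzl n) (jonesWenzl n) = jonesWenzl n := by
  cases n with
  | zero => exact one_comp _
  | succ n => exact (jonesWenzl_properties n).1

theorem jonesWenzl_comp_strand (n : ℕ) :
    comp (jonesWenzl (n + 1)) (strand (jonesWenzl n)) = jonesWenzl (n + 1) :=
  (jonesWenzl_properties n).2.1

theorem partialTrace_jonesWenzl (n : ℕ) :
    comp (capLast n) (comp (strand (jonesWenzl (n + 1))) (cupLast n)) =
      (qInt (n + 2) / qInt (n + 1)) • jonesWenzl n :=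
  (jonesWenzl_properties n).2.2.1

theorem jonesWenzl_comp_cupLast (n : ℕ) : comp (jonesWenzl (n + 2)) (cupLast n) = 0 :=
  (jonesWenzl_properties n).2.2.2

end JonesWenzl

/-! ### Admissible sequences -/

section Sequences

variable {n : ℕ}

theorem size_snoc (ε : Fin n → ℤˣ) (a : ℤˣ) : size (Fin.snoc ε a : Fin (n + 1) → ℤˣ) =
    size ε + a := by
  simp [size, Fin.sum_univ_castSucc]

/-- The harmless case `k = 0` is added, and the sums become sums of conditionals, from which the
last term can be split off. -/
theorem admissible_iff (ε : Fin n → ℤˣ) : Admissible ε ↔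
    ∀ k ≤ n, 0 ≤ ∑ i : Fin n, if (i : ℕ) < k then (ε i : ℤ) else 0 := by
  simp only [Admissible, Finset.sum_filter, Finset.mem_Icc]
  refine ⟨fun h k hk => ?_, fun h k hk => h k hk.2⟩
  rcases Nat.eq_zero_or_pos k with rfl | hk'
  · simp
  · exact h k ⟨hk', hk⟩

theorem snoc_mem_L_iff (ε : Fin n → ℤˣ) (a : ℤˣ) :
    (Fin.snoc ε a : Fin (n + 1) → ℤˣ) ∈ L (n + 1) ↔ ε ∈ L n ∧ 0 ≤ size ε + a := by
  have whole : ∑ i : Fin (n + 1), (if (i : ℕ) < n + 1 then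
      ((Fin.snoc ε a : Fin (n + 1) → ℤˣ) i : ℤ) else 0) = size ε + a := by
    rw [← size_snoc, size]
    exact Finset.sum_congr rfl fun i _ => if_pos i.2
  have part (k : ℕ) (hk : k ≤ n) : ∑ i : Fin (n + 1), (if (i : ℕ) < k then
      ((Fin.snoc ε a : Fin (n + 1) → ℤˣ) i : ℤ) else 0) =
      ∑ i : Fin n, if (i : ℕ) < k then (ε i : ℤ) else 0 := by
    simp [Fin.sum_univ_castSucc, hk.not_gt]
  simp only [L, Finset.mem_filter, Finset.mem_univ, true_and, admissible_iff]
  constructor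
  · exact fun h => ⟨fun k hk => part k hk ▸ h k (by omega), whole ▸ h (n + 1) le_rfl⟩
  · rintro ⟨h, h'⟩ k hk
    rcases Nat.le_succ_iff.1 hk with hk | rfl
    · exact part k hk ▸ h k hk
    · exact whole ▸ h'

theorem size_nonneg {ε : Fin n → ℤˣ} (hε : ε ∈ L n) : 0 ≤ size ε := by
  cases n with
  | zero => simp [size]
  | succ n =>
    rw [← Fin.snoc_init_self ε] at hε ⊢
    rw [size_snoc]
    exact ((snoc_mem_L_iff _ _).1 hε).2

theorem toNat_size_snoc_one {ε : Fin n → ℤˣ} (hε : ε ∈ L n) :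
    (size (Fin.snoc ε 1 : Fin (n + 1) → ℤˣ)).toNat = (size ε).toNat + 1 := by
  have := size_nonneg hε
  rw [size_snoc, Units.val_one]
  omega

/-- The admissible sequences of length `n + 1` arise from those of length `n` by appending `1`, or
`-1` if the size is positive. -/
theorem mem_L_succ {ν : Fin (n + 1) → ℤˣ} (hν : ν ∈ L (n + 1)) :
    ∃ ε ∈ L n, (ν = Fin.snoc ε 1 ∧ (size ν).toNat = (size ε).toNat + 1) ∨
      (ν = Fin.snoc ε (-1) ∧ (size ε).toNat = (size ν).toNat + 1) := by
  obtain ⟨ε, a, rfl⟩ : ∃ ε a, ν = Fin.snoc ε a := ⟨_, _, (Fin.snoc_init_self ν).symm⟩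
  obtain ⟨hε, h⟩ := (snoc_mem_L_iff _ _).1 hν
  refine ⟨ε, hε, ?_⟩
  rcases Int.units_eq_one_or a with rfl | rfl
  · exact .inl ⟨rfl, toNat_size_snoc_one hε⟩
  · refine .inr ⟨rfl, ?_⟩
    rw [size_snoc]
    simp only [Units.val_neg, Units.val_one] at h ⊢
    omega

/-! ### The elements `t_ε` and their products -/

theorem top_snoc_one (k : ℕ) (ε : Fin n → ℤˣ) :
    top (n + 1) (k + 1) (Fin.snoc ε 1) = comp (strand (top n k ε)) (jonesWenzl (k + 1)) := by
  simp [top]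

/-- Merges the two clauses of the definition, for `k = 0` and `k > 0`. -/
theorem top_snoc_neg_one (k : ℕ) (ε : Fin n → ℤˣ) :
    top (n + 1) k (Fin.snoc ε (-1)) =
      comp (strand (top n (k + 1) ε)) (comp (strand (jonesWenzl (k + 1))) (cupLast k)) := by
  have : (-1 : ℤˣ) ≠ 1 := by decide
  cases k <;> simp [top, this, cupLast]

/-- The inverse of the scalar by which `t̄_ε t_ε` differs from a Jones-Wenzl projector. -/
noncomputable def normalization : (n : ℕ) → (Fin n → ℤˣ) → Cq
  | 0, _ => 1
  | n + 1, ε => normalization n (Fin.init ε) *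
      if ε (Fin.last n) = 1 then 1
      else qInt (size (Fin.init ε)).toNat / qInt ((size (Fin.init ε)).toNat + 1)

theorem normalization_snoc_one (ε : Fin n → ℤˣ) :
    normalization (n + 1) (Fin.snoc ε 1) = normalization n ε := by
  simp [normalization]

theorem normalization_snoc_neg_one (ε : Fin n → ℤˣ) :
    normalization (n + 1) (Fin.snoc ε (-1)) =
      normalization n ε * (qInt (size ε).toNat / qInt ((size ε).toNat + 1)) := by
  have : (-1 : ℤˣ) ≠ 1 := by decide
  simp [normalization, this]

/-- Before a sign `-1` an admissible prefix has positive size, so the vanishing `[0]` never enters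
as a numerator. -/
theorem normalization_ne_zero {ε : Fin n → ℤˣ} (hε : ε ∈ L n) : normalization n ε ≠ 0 := by
  induction n with
  | zero => exact one_ne_zero
  | succ n ih =>
    obtain ⟨μ, hμ, ⟨rfl, -⟩ | ⟨rfl, h⟩⟩ := mem_L_succ hε
    · rw [normalization_snoc_one]
      exact ih hμ
    · rw [normalization_snoc_neg_one, h]
      exact mul_ne_zero (ih hμ)
        (div_ne_zero (qInt_ne_zero (by omega)) (qInt_ne_zero (by omega)))

/-- After a sign `+1` this is idempotence. After `-1`, the projector slides up through the cup and
is absorbed by the larger one. -/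
theorem top_comp_jonesWenzl (n k : ℕ) (ε : Fin n → ℤˣ) :
    comp (top n k ε) (jonesWenzl k) = top n k ε := by
  cases n with
  | zero => cases k with
    | zero => exact comp_one _
    | succ k => simp [top]
  | succ n =>
    obtain ⟨ε, a, rfl⟩ : ∃ μ a, ε = Fin.snoc μ a := ⟨_, _, (Fin.snoc_init_self ε).symm⟩
    rcases Int.units_eq_one_or a with rfl | rfl
    · cases k with
      | zero => simp [top]
      | succ k => rw [top_snoc_one, comp_assoc, jonesWenzl_comp_self]
    · rw [top_snoc_neg_one, comp_assoc, comp_assoc, ← strand_strand_comp_cupLast,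
        ← comp_assoc (strand (jonesWenzl (k + 1))), ← strand_comp, jonesWenzl_comp_strand]

/-- The products `t̄_ε t_ε`. -/
theorem bar_top_comp_top_self {ε : Fin n → ℤˣ} (hε : ε ∈ L n) {k : ℕ}
    (hk : (size ε).toNat = k) :
    comp (bar (top n k ε)) (top n k ε) = (normalization n ε)⁻¹ • jonesWenzl k := by
  induction n generalizing k with
  | zero =>
    obtain rfl : k = 0 := by simpa [size] using hk.symm
    simp [top, normalization, jonesWenzl, bar_one, one_comp]
  | succ n ih =>
    obtain ⟨μ, hμ, ⟨rfl, h⟩ | ⟨rfl, h⟩⟩ := mem_L_succ hε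
    · obtain rfl : k = (size μ).toNat + 1 := hk.symm.trans h
      rw [top_snoc_one, bar_comp, comp_assoc, ← comp_assoc (bar (strand _)), bar_strand,
        ← strand_comp, ih hμ rfl, normalization_snoc_one]
      simp only [map_smul, LinearMap.smul_apply]
      rw [bar_jonesWenzl, ← comp_assoc, jonesWenzl_comp_strand, jonesWenzl_comp_self]
    · rw [hk] at h
      rw [top_snoc_neg_one, bar_comp, comp_assoc, ← comp_assoc (bar (strand (top _ _ _))),
        bar_strand, ← strand_comp, ih hμ h, normalization_snoc_neg_one, h]
      simp only [map_smul, LinearMap.smul_apply]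
      -- The three copies of the projector merge into one between cap and cup, a partial trace.
      rw [← comp_assoc (strand (jonesWenzl _)), ← strand_comp, jonesWenzl_comp_self, bar_comp,
        bar_strand, bar_jonesWenzl, bar_cupLast, comp_assoc,
        ← comp_assoc (strand (jonesWenzl _)), ← strand_comp, jonesWenzl_comp_self,
        partialTrace_jonesWenzl, smul_smul, mul_inv, inv_div]

/-- The products `t̄_ε t_ν` for `ε ≠ ν`. -/
theorem bar_top_comp_top_of_ne {ε ν : Fin n → ℤˣ} (hε : ε ∈ L n) (hν : ν ∈ L n) (hne : ε ≠ ν)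
    {k l : ℕ} (hk : (size ε).toNat = k) (hl : (size ν).toNat = l) :
    comp (bar (top n k ε)) (top n l ν) = 0 := by
  induction n generalizing k l with
  | zero => exact absurd (Subsingleton.elim _ _) hne
  | succ n ih =>
    obtain ⟨μ, hμ, h⟩ := mem_L_succ hε
    obtain ⟨ρ, hρ, h'⟩ := mem_L_succ hν
    by_cases hμρ : μ = ρ
    · subst hμρ
      rcases h with ⟨rfl, h⟩ | ⟨rfl, h⟩ <;> rcases h' with ⟨rfl, h'⟩ | ⟨rfl, h'⟩
      · exact absurd rfl hne
      · rw [hl] at h'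
        obtain rfl : k = l + 2 := by omega
        rw [top_snoc_one, top_snoc_neg_one, bar_comp, bar_strand, comp_assoc,
          ← comp_assoc (strand (bar _)), ← strand_comp, bar_top_comp_top_self hμ h']
        simp only [map_smul, LinearMap.smul_apply]
        rw [← comp_assoc (strand (jonesWenzl _)), ← strand_comp, jonesWenzl_comp_self,
          bar_jonesWenzl, ← comp_assoc, jonesWenzl_comp_strand, jonesWenzl_comp_cupLast,
          smul_zero]
      · rw [hk] at h
        obtain rfl : l = k + 2 := by omega
        -- Flipping upside down exchanges the two mixed cases.
        suffices h₀ : comp (bar (top (n + 1) (k + 2) (Fin.snoc μ 1)))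
            (top (n + 1) k (Fin.snoc μ (-1))) = 0 by
          simpa only [bar_comp, bar_bar, map_zero] using congrArg bar h₀
        rw [top_snoc_one, top_snoc_neg_one, bar_comp, bar_strand, comp_assoc,
          ← comp_assoc (strand (bar _)), ← strand_comp, bar_top_comp_top_self hμ h]
        simp only [map_smul, LinearMap.smul_apply]
        rw [← comp_assoc (strand (jonesWenzl _)), ← strand_comp, jonesWenzl_comp_self,
          bar_jonesWenzl, ← comp_assoc, jonesWenzl_comp_strand, jonesWenzl_comp_cupLast,
          smul_zero]
      · exact absurd rfl hne
    -- Whatever the last sign, the prefix splits off at the top; the induction hypothesis then kills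
    -- the middle of the product.
    · have factor (k : ℕ) (ε : Fin (n + 1) → ℤˣ) (μ : Fin n → ℤˣ)
          (h : (ε = Fin.snoc μ 1 ∧ k = (size μ).toNat + 1) ∨
            (ε = Fin.snoc μ (-1) ∧ (size μ).toNat = k + 1)) :
          ∃ x, top (n + 1) k ε = comp (strand (top n (size μ).toNat μ)) x := by
        rcases h with ⟨rfl, rfl⟩ | ⟨rfl, h⟩
        · exact ⟨_, top_snoc_one _ _⟩
        · rw [h]
          exact ⟨_, top_snoc_neg_one _ _⟩
      obtain ⟨x, hx⟩ := factor k ε μ (hk ▸ h)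
      obtain ⟨y, hy⟩ := factor l ν ρ (hl ▸ h')
      rw [hx, hy, bar_comp, bar_strand, comp_assoc, ← comp_assoc (strand (bar _)),
        ← strand_comp, ih hμ hρ hμρ rfl rfl]
      simp

/-! ### Path idempotents and the branching rule -/

theorem qElt_eq {ε : Fin n → ℤˣ} {k : ℕ} (hk : (size ε).toNat = k) :
    qElt ε = comp (top n k ε) (bar (top n k ε)) := by
  subst hk; rfl

theorem qElt_comp_of_ne {ε ν : Fin n → ℤˣ} (hε : ε ∈ L n) (hν : ν ∈ L n) (hne : ε ≠ ν) :
    comp (qElt ε) (qElt ν) = 0 := by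
  rw [qElt, qElt, comp_assoc, ← comp_assoc (bar _), bar_top_comp_top_of_ne hε hν hne rfl rfl]
  simp

theorem qElt_comp_self {ε : Fin n → ℤˣ} (hε : ε ∈ L n) :
    comp (qElt ε) (qElt ε) = (normalization n ε)⁻¹ • qElt ε := by
  rw [qElt, comp_assoc, ← comp_assoc (bar _), bar_top_comp_top_self hε rfl]
  simp only [map_smul, LinearMap.smul_apply]
  rw [← comp_assoc, top_comp_jonesWenzl]

/-- Like `qElt_snoc_neg_one` and `strand_qElt`, this exhibits a middle factor between `t_ε ⊔ 1` and
its flip. The branching rule thereby becomes an identity between middle factors, namely Wenzl's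
recurrence. -/
theorem qElt_snoc_one {ε : Fin n → ℤˣ} (hε : ε ∈ L n) {k : ℕ} (hk : (size ε).toNat = k) :
    qElt (Fin.snoc ε 1 : Fin (n + 1) → ℤˣ) =
      comp (strand (top n k ε)) (comp (jonesWenzl (k + 1)) (strand (bar (top n k ε)))) := by
  rw [qElt_eq ((toNat_size_snoc_one hε).trans (congrArg (· + 1) hk)), top_snoc_one, bar_comp,
    bar_strand, bar_jonesWenzl, comp_assoc, ← comp_assoc (jonesWenzl _), jonesWenzl_comp_self]

theorem qElt_snoc_neg_one {ε : Fin n → ℤˣ} {k : ℕ} (hk : (size ε).toNat = k + 1) :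
    qElt (Fin.snoc ε (-1) : Fin (n + 1) → ℤˣ) =
      comp (strand (top n (k + 1) ε))
        (comp (comp (comp (strand (jonesWenzl (k + 1))) (cupLast k))
          (comp (capLast k) (strand (jonesWenzl (k + 1))))) (strand (bar (top n (k + 1) ε)))) := by
  have : (size (Fin.snoc ε (-1) : Fin (n + 1) → ℤˣ)).toNat = k := by
    rw [size_snoc, Units.val_neg, Units.val_one]
    omega
  rw [qElt_eq this, top_snoc_neg_one]
  simp only [bar_comp, bar_strand, bar_jonesWenzl, bar_cupLast, comp_assoc]

theorem strand_qElt {ε : Fin n → ℤˣ} {k : ℕ} (hk : (size ε).toNat = k) :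
    strand (qElt ε) = comp (strand (top n k ε))
      (comp (strand (jonesWenzl k)) (strand (bar (top n k ε)))) := by
  rw [qElt_eq hk, ← comp_assoc, ← strand_comp, top_comp_jonesWenzl, strand_comp]

/-- The elements `p_ε`, extended by zero to the sequences that are not admissible. -/
noncomputable def pathIdempotent (n : ℕ) (ε : Fin n → ℤˣ) : TL n n :=
  if ε ∈ L n then normalization n ε • qElt ε else 0

theorem pathIdempotent_of_mem {ε : Fin n → ℤˣ} (hε : ε ∈ L n) :
    pathIdempotent n ε = normalization n ε • qElt ε :=
  if_pos hε

theorem pathIdempotent_of_notMem {ε : Fin n → ℤˣ} (hε : ε ∉ L n) : pathIdempotent n ε = 0 :=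
  if_neg hε

theorem strand_pathIdempotent {ε : Fin n → ℤˣ} (hε : ε ∈ L n) :
    strand (pathIdempotent n ε) =
      pathIdempotent (n + 1) (Fin.snoc ε 1) + pathIdempotent (n + 1) (Fin.snoc ε (-1)) := by
  have hsize := size_nonneg hε
  rw [pathIdempotent_of_mem hε,
    pathIdempotent_of_mem ((snoc_mem_L_iff ε 1).2 ⟨hε, by rw [Units.val_one]; omega⟩),
    normalization_snoc_one, map_smul]
  obtain hk | ⟨k, hk⟩ : (size ε).toNat = 0 ∨ ∃ k, (size ε).toNat = k + 1 := by
    cases (size ε).toNat <;> simp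
  -- At size `0` appending `-1` is not admissible, and the recurrence degenerates to `p_1 = p_0 ⊔
  -- 1`.
  · rw [pathIdempotent_of_notMem, add_zero, strand_qElt hk, qElt_snoc_one hε hk]
    · simp only [jonesWenzl, strand_one]
    · rw [snoc_mem_L_iff, Units.val_neg, Units.val_one]
      omega
  · rw [pathIdempotent_of_mem, normalization_snoc_neg_one, hk, mul_smul, ← smul_add,
      strand_qElt hk, qElt_snoc_one hε hk, qElt_snoc_neg_one hk, jonesWenzl_add_two]
    · simp only [map_sub, map_smul, LinearMap.sub_apply, LinearMap.smul_apply, sub_add_cancel]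
    · rw [snoc_mem_L_iff, Units.val_neg, Units.val_one]
      exact ⟨hε, by omega⟩

theorem pathIdempotent_comp_self {ε : Fin n → ℤˣ} (hε : ε ∈ L n) :
    comp (pathIdempotent n ε) (pathIdempotent n ε) = pathIdempotent n ε := by
  simp only [pathIdempotent_of_mem hε, map_smul, LinearMap.smul_apply, qElt_comp_self hε]
  rw [smul_inv_smul₀ (normalization_ne_zero hε)]

theorem one_eq_sum_pathIdempotent (n : ℕ) : one n = ∑ ε ∈ L n, pathIdempotent n ε := by
  -- Summing over all sequences allows the last sign to be split off by `Fin.snocEquiv`.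
  have extend (n : ℕ) : ∑ ε ∈ L n, pathIdempotent n ε = ∑ ε, pathIdempotent n ε :=
    Finset.sum_subset (Finset.subset_univ _) fun ε _ hε => pathIdempotent_of_notMem hε
  induction n with
  | zero =>
    have h (ε : Fin 0 → ℤˣ) : ε ∈ L 0 :=
      Finset.mem_filter.2 ⟨Finset.mem_univ _, fun k _ => by simp⟩
    rw [extend, Fintype.sum_unique, pathIdempotent_of_mem (h _), normalization, one_smul,
      qElt_eq (k := 0) (by simp [size])]
    simp only [top, bar_one, one_comp]
  | succ n ih =>
    rw [← strand_one, ih, map_sum, Finset.sum_congr rfl fun ε hε => strand_pathIdempotent hε,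
      extend, ← (Fin.snocEquiv fun _ => ℤˣ).sum_comp, Fintype.sum_prod_type_right]
    have pair (ε : Fin n → ℤˣ) : ∑ a, pathIdempotent (n + 1) (Fin.snocEquiv (fun _ => ℤˣ) (a, ε)) =
        pathIdempotent (n + 1) (Fin.snoc ε 1) + pathIdempotent (n + 1) (Fin.snoc ε (-1)) :=
      Finset.sum_pair (by decide)
    simp only [pair]
    -- Both extensions of an inadmissible sequence are inadmissible and contribute zero.
    refine Finset.sum_subset (Finset.subset_univ _) fun ε _ hε => ?_
    rw [pathIdempotent_of_notMem fun h => hε ((snoc_mem_L_iff _ _).1 h).1,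
      pathIdempotent_of_notMem fun h => hε ((snoc_mem_L_iff _ _).1 h).1, add_zero]

end Sequences

end TemperleyLieb

open TemperleyLieb in
theorem mainTheorem9 :
    (∀ (n : ℕ), ∀ ε ∈ L n, ∀ ν ∈ L n, ε ≠ ν → comp (qElt ε) (qElt ν) = 0) ∧
    ∃ (f : (n : ℕ) → (Fin n → ℤˣ) → Cq) (p : (n : ℕ) → (Fin n → ℤˣ) → TL n n),
      (∀ (n : ℕ), ∀ ε ∈ L n, f n ε ≠ 0 ∧ p n ε = f n ε • qElt ε) ∧
      (∀ (n : ℕ) (ε : Fin n → ℤˣ), ε ∉ L n → p n ε = 0) ∧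
      (∀ (n : ℕ), ∀ ε ∈ L n, comp (p n ε) (p n ε) = p n ε) ∧
      (∀ (n : ℕ), one n = ∑ ε ∈ L n, p n ε) ∧
      (∀ (n : ℕ), ∀ ε ∈ L n,
        strand (p n ε) = p (n + 1) (Fin.snoc ε 1) + p (n + 1) (Fin.snoc ε (-1))) := by
  refine ⟨fun n ε hε ν hν => qElt_comp_of_ne hε hν, normalization, pathIdempotent,
    fun n ε hε => ⟨normalization_ne_zero hε, pathIdempotent_of_mem hε⟩,
    fun n ε => pathIdempotent_of_notMem, fun n ε => pathIdempotent_comp_self,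
    one_eq_sum_pathIdempotent, fun n ε => strand_pathIdempotent⟩
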